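/- Let $p$ be an odd prime and $\zeta\in\mathbb{C}$ a primitive $p$-th root of unity. Let $\Sigma_p$ act on the right of $\{1,\dots,p\}$ and be embedded in the unitary group $U(p)$ by permutation matrices, $\sigma_{i,j}=1$ if $(i)\sigma=j$ and $\sigma_{i,j}=0$ otherwise. Let $A\in U(p)$ be the diagonal matrix with $A_{ii}=\zeta^{i-1}$, let $B$ be the permutation matrix of the $p$-cycle $(1,2,\dots,p)$, let $\tau$ be the permutation matrix of $(2,p)(3,p-1)\cdots(\tfrac{p+1}{2},\tfrac{p+3}{2})$, and let $\Gamma\subset U(p)$ be the subgroup generated by $A$, $B$ and $S^1=Z(U(p))$, the group of scalar unitary matrices. Then $\tau$ is an element of order $2$ of the normalizer $N_{U(p)}\Gamma$, and the following hold. 1. There is a short exact sequence $$1\to\Gamma\to N_{U(p)}\Gamma\xrightarrow{\ \pi\ }SL_2\mathbb{F}_p\to 1,$$ in which the first map is the inclusion and $\pi(x)$ is the matrix of the action of $x$ by conjugation on $\Gamma/S^1\cong\mathbb{F}_p\times\mathbb{F}_p$ in the basis given by the classes of $A$ and $B$; that is, if $\pi(x)=\begin{pmatrix}a&b\\c&d\end{pmatrix}$,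 then $xAx^{-1}\in S^1A^aB^c$ and $xBx^{-1}\in S^1A^bB^d$. 2. This extension splits: there is a group homomorphism $s\colon SL_2\mathbb{F}_p\to N_{U(p)}\Gamma$ with $\pi\circ s=\mathrm{id}$. 3. The section $s$ can be chosen with values in the centralizer $C_{N_{U(p)}\Gamma}(\tau)$ of $\tau$ in $N_{U(p)}\Gamma$ and such that $(z,g)\mapsto z\,s(g)$ is an isomorphism of topological groups $$S^1\times SL_2\mathbb{F}_p\;\cong\;C_{N_{U(p)}\Gamma}(\tau),$$ where $SL_2\mathbb{F}_p$ is discrete. -/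

import Mathlib

open Matrix

/-- The permutation matrix of `σ`, with entry `1` at `(i, j)` exactly when `σ` sends `i` to `j`,
as an element of `U(p)`. The index `i : Fin p` stands for the element `i + 1` of `{1, …, p}`. -/
noncomputable def permU {p : ℕ} (σ : Equiv.Perm (Fin p)) : Matrix.unitaryGroup (Fin p) ℂ :=
  ⟨σ.permMatrix ℂ, by
    rw [Matrix.mem_unitaryGroup_iff, Matrix.star_eq_conjTranspose, Matrix.conjTranspose_permMatrix,
      ← Matrix.permMatrix_mul]
    simp⟩

/-- The diagonal matrix `A` with diagonal `1, ζ, …, ζ ^ (p - 1)`. -/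
noncomputable def matA {p : ℕ} [NeZero p] {ζ : ℂ} (hζ : IsPrimitiveRoot ζ p) :
    Matrix.unitaryGroup (Fin p) ℂ :=
  ⟨Matrix.diagonal fun i : Fin p => ζ ^ (i : ℕ), by
    have h1 : ζ * star ζ = 1 := by
      have h := Complex.norm_eq_one_of_pow_eq_one hζ.pow_eq_one (NeZero.ne p)
      rw [Complex.star_def, Complex.mul_conj, Complex.normSq_eq_norm_sq, h]
      norm_num
    rw [Matrix.mem_unitaryGroup_iff, Matrix.star_eq_conjTranspose,
      Matrix.diagonal_conjTranspose, Matrix.diagonal_mul_diagonal, ← Matrix.diagonal_one]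
    congr 1
    funext i
    simp only [Pi.star_apply, star_pow]
    rw [← mul_pow, h1, one_pow]⟩

/-- The matrix `B` of the `p`-cycle `(1, 2, …, p)`. -/
noncomputable def matB (p : ℕ) : Matrix.unitaryGroup (Fin p) ℂ :=
  permU (finRotate p)

/-- The involution `τ = (2, p)(3, p - 1) ⋯ ((p + 1) / 2, (p + 3) / 2)`. On `Fin p`, whose
arithmetic is modulo `p` and whose element `i` stands for `i + 1`, it is `i ↦ -i`. -/
noncomputable def tauU (p : ℕ) [NeZero p] : Matrix.unitaryGroup (Fin p) ℂ :=
  permU (Equiv.neg (Fin p))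

/-- The subgroup `Γ` of `U(p)` generated by `A`, `B` and the centre of `U(p)`. -/
noncomputable def Gam {p : ℕ} [NeZero p] {ζ : ℂ} (hζ : IsPrimitiveRoot ζ p) :
    Subgroup (Matrix.unitaryGroup (Fin p) ℂ) :=
  Subgroup.closure
    ({matA hζ, matB p} ∪ (Subgroup.center (Matrix.unitaryGroup (Fin p) ℂ) :
      Set (Matrix.unitaryGroup (Fin p) ℂ)))

/-- The normalizer of `Γ` in `U(p)`. -/
noncomputable abbrev normGam {p : ℕ} [NeZero p] {ζ : ℂ} (hζ : IsPrimitiveRoot ζ p) :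
    Subgroup (Matrix.unitaryGroup (Fin p) ℂ) :=
  Subgroup.normalizer (Gam hζ : Set (Matrix.unitaryGroup (Fin p) ℂ))

/-- The centralizer of `τ` in the normalizer of `Γ`. -/
noncomputable abbrev centTau {p : ℕ} [NeZero p] {ζ : ℂ} (hζ : IsPrimitiveRoot ζ p) :
    Subgroup (Matrix.unitaryGroup (Fin p) ℂ) :=
  normGam hζ ⊓ Subgroup.centralizer {tauU p}

/-- Conjugation by `x` induces the linear map with matrix `M` (acting on column vectors) on
`Γ / Z(U(p))`, written in the basis given by the classes of `A` and `B`. -/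
def ActsBy {p : ℕ} [NeZero p] {ζ : ℂ} (hζ : IsPrimitiveRoot ζ p)
    (x : Matrix.unitaryGroup (Fin p) ℂ) (M : Matrix (Fin 2) (Fin 2) (ZMod p)) : Prop :=
  x * matA hζ * x⁻¹ * (matA hζ ^ (M 0 0).val * matB p ^ (M 1 0).val)⁻¹ ∈
      Subgroup.center (Matrix.unitaryGroup (Fin p) ℂ) ∧
    x * matB p * x⁻¹ * (matA hζ ^ (M 0 1).val * matB p ^ (M 1 1).val)⁻¹ ∈
      Subgroup.center (Matrix.unitaryGroup (Fin p) ℂ)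

/-! Write `ψ` for the character `circleChar` and `W(v)` for the Weyl operator `weylU`, the multiple
of `A ^ v 0 * B ^ v 1` normalized so that `W(u) W(v) = ψ(halfForm u v) W(u + v)`. Since `p` is odd,
the cocycle can be taken alternating, hence invariant under `SL₂(𝔽_p)`. `Γ` consists of the scalar
multiples of the `W(v)`.

Exactness: conjugation by a normalizing `x` induces an additive map on the labels `v`, and
commutators force its determinant to be `1` (`exists_actsOnWeyl_of_mem_normGam`). If the map is
trivial, `x` acts on the `W(v)` through a character of the labels, as some `W(u)` does, so Schur's
lemma puts `x` in `Γ` (`ActsOnWeyl.mem_Gam`). Every `M` occurs: averaging over the `W(v)` gives a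
unitary intertwiner from `W(v)` to `W(M v)` (`exists_weylU_intertwiner`).

Splitting: `τ W(v) τ⁻¹ = W(-v)`, so an intertwiner commutes with `τ` up to a scalar, which is `1`
because `τ` has nonzero trace (`exists_mem_centTau`). Hence the centralizer of `τ` surjects onto
`SL₂(𝔽_p)`, with kernel the scalars. The eigenspaces of `τ` have dimensions `(p + 1) / 2` and `(p -
1) / 2`, which differ by one, so the quotient of the determinants on them is a character restricting
to the identity on scalars (`tauChar_scalarU`). Paired with the action, it identifies the
centralizer with the product (`centTauHom_bijective`), for all odd `p` at once. -/

section Weyl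

/-! ### Weyl operators and their multiplication law. -/

/-- The root of unity `ζ` as an element of the circle. -/
noncomputable def circleRoot {p : ℕ} [NeZero p] {ζ : ℂ} (hζ : IsPrimitiveRoot ζ p) : Circle :=
  ⟨ζ, mem_sphere_zero_iff_norm.2
    (Complex.norm_eq_one_of_pow_eq_one hζ.pow_eq_one (NeZero.ne p))⟩

lemma isPrimitiveRoot_circleRoot {p : ℕ} [NeZero p] {ζ : ℂ} (hζ : IsPrimitiveRoot ζ p) :
    IsPrimitiveRoot (circleRoot hζ) p :=
  IsPrimitiveRoot.of_map_of_injective (f := Circle.coeHom) hζ Circle.coe_injective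

/-- The additive character `k ↦ ζ ^ k` of `ZMod p` with values in the circle. -/
noncomputable def circleChar {p : ℕ} [NeZero p] {ζ : ℂ} (hζ : IsPrimitiveRoot ζ p) :
    AddChar (ZMod p) Circle :=
  AddChar.zmodChar p (isPrimitiveRoot_circleRoot hζ).pow_eq_one

lemma circleChar_eq_one_iff {p : ℕ} [NeZero p] {ζ : ℂ} (hζ : IsPrimitiveRoot ζ p) (a : ZMod p) :
    circleChar hζ a = 1 ↔ a = 0 :=
  (AddChar.zmodChar_primitive_of_primitive_root p
    (isPrimitiveRoot_circleRoot hζ)).zmod_char_eq_one_iff p a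

lemma circleChar_injective {p : ℕ} [NeZero p] {ζ : ℂ} (hζ : IsPrimitiveRoot ζ p) :
    Function.Injective (circleChar hζ) := by
  intro a b h
  rw [← sub_eq_zero, ← circleChar_eq_one_iff hζ, AddChar.map_sub_eq_div, h, div_self']

lemma circleChar_natCast {p : ℕ} [NeZero p] {ζ : ℂ} (hζ : IsPrimitiveRoot ζ p) (k : ℕ) :
    circleChar hζ k = circleRoot hζ ^ k :=
  AddChar.zmodChar_apply' _ k

lemma exists_circleChar_eq {p : ℕ} [NeZero p] {ζ : ℂ} (hζ : IsPrimitiveRoot ζ p) {z : Circle}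
    (hz : z ^ p = 1) : ∃ k, circleChar hζ k = z := by
  obtain ⟨k, -, hk⟩ := hζ.eq_pow_of_pow_eq_one (ξ := (z : ℂ)) (by
    rw [← Circle.coe_pow, hz, Circle.coe_one])
  refine ⟨k, Circle.ext ?_⟩
  rw [circleChar_natCast, Circle.coe_pow, ← hk]
  rfl

/-- The scalar unitary matrices. -/
noncomputable def scalarU (p : ℕ) : Circle →* Matrix.unitaryGroup (Fin p) ℂ where
  toFun z := ⟨(z : ℂ) • 1, by
    rw [Matrix.mem_unitaryGroup_iff, star_smul, star_one, smul_mul_smul_comm, one_mul,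
      Complex.star_def, Complex.mul_conj, Circle.normSq_coe, Complex.ofReal_one, one_smul]⟩
  map_one' := by ext; simp
  map_mul' z w := by
    apply Subtype.ext
    simp [smul_smul, mul_comm]

lemma coe_scalarU {p : ℕ} (z : Circle) :
    (scalarU p z : Matrix (Fin p) (Fin p) ℂ) = (z : ℂ) • 1 := rfl

lemma coe_scalarU_mul {p : ℕ} (z : Circle) (x : Matrix.unitaryGroup (Fin p) ℂ) :
    ((scalarU p z * x : Matrix.unitaryGroup (Fin p) ℂ) : Matrix (Fin p) (Fin p) ℂ) =
      (z : ℂ) • (x : Matrix (Fin p) (Fin p) ℂ) := by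
  rw [Submonoid.coe_mul, coe_scalarU, smul_mul_assoc, one_mul]

lemma scalarU_comm {p : ℕ} (z : Circle) (x : Matrix.unitaryGroup (Fin p) ℂ) :
    scalarU p z * x = x * scalarU p z := by
  apply Subtype.ext
  simp [coe_scalarU]

lemma scalarU_injective {p : ℕ} [NeZero p] : Function.Injective (scalarU p) := by
  intro z w h
  have := congrArg (fun x : Matrix.unitaryGroup (Fin p) ℂ =>
    (x : Matrix (Fin p) (Fin p) ℂ) 0 0) h
  simpa [coe_scalarU, Circle.ext_iff] using this

lemma exists_scalarU_eq {p : ℕ} [NeZero p] {x : Matrix.unitaryGroup (Fin p) ℂ} {c : ℂ}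
    (h : (x : Matrix (Fin p) (Fin p) ℂ) = c • 1) : ∃ z, x = scalarU p z := by
  have hx := Matrix.mem_unitaryGroup_iff.1 x.2
  rw [h, star_smul, star_one, smul_mul_smul_comm, one_mul, Complex.star_def,
    Complex.mul_conj] at hx
  have h0 := congrFun (congrFun hx 0) 0
  simp only [Matrix.smul_apply, one_apply_eq, smul_eq_mul, mul_one] at h0
  have h1 : ‖c‖ = 1 := by
    rw [Complex.normSq_eq_norm_sq] at h0
    have h2 : ‖c‖ ^ 2 = 1 := by exact_mod_cast h0
    exact (pow_eq_one_iff_of_nonneg (norm_nonneg c) two_ne_zero).1 h2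
  exact ⟨⟨c, mem_sphere_zero_iff_norm.2 h1⟩, Subtype.ext h⟩

lemma finEquiv_apply_add_one {p : ℕ} [NeZero p] (i : Fin p) :
    ZMod.finEquiv p (i + 1) = ZMod.finEquiv p i + 1 := by
  obtain _ | n := p
  · exact i.elim0
  · rfl

lemma finEquiv_apply_neg {p : ℕ} [NeZero p] (i : Fin p) :
    ZMod.finEquiv p (-i) = -ZMod.finEquiv p i := by
  obtain _ | n := p
  · exact i.elim0
  · rfl

lemma natCast_val_eq_finEquiv {p : ℕ} [NeZero p] (i : Fin p) :
    ((i : ℕ) : ZMod p) = ZMod.finEquiv p i := by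
  obtain _ | n := p
  · exact i.elim0
  · exact Fin.cast_val_eq_self i

variable {p : ℕ} [Fact p.Prime] {ζ : ℂ} (hζ : IsPrimitiveRoot ζ p)

/-- Half of the standard symplectic form. -/
def halfForm (u v : Fin 2 → ZMod p) : ZMod p := 2⁻¹ * (u 1 * v 0 - u 0 * v 1)

/-- The matrix of the Weyl operator attached to `v`, a multiple of `A ^ v 0 * B ^ v 1`. -/
noncomputable def weylMatrix (v : Fin 2 → ZMod p) : Matrix (Fin p) (Fin p) ℂ :=
  Matrix.of fun i j => if ZMod.finEquiv p j = ZMod.finEquiv p i + v 1 then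
    (circleChar hζ (v 0 * ZMod.finEquiv p i + 2⁻¹ * v 0 * v 1) : ℂ) else 0

lemma two_ne_zero_zmod (hp : Odd p) : (2 : ZMod p) ≠ 0 := by
  intro h
  have h1 : ((2 : ℕ) : ZMod p) = 0 := by exact_mod_cast h
  rw [ZMod.natCast_eq_zero_iff] at h1
  have := (Nat.prime_dvd_prime_iff_eq Fact.out Nat.prime_two).1 h1
  subst this
  exact absurd hp (by decide)

lemma weylMatrix_mul (hp : Odd p) (u v : Fin 2 → ZMod p) :
    weylMatrix hζ u * weylMatrix hζ v =
      (circleChar hζ (halfForm u v) : ℂ) • weylMatrix hζ (u + v) := by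
  have h2 := two_ne_zero_zmod hp
  ext i j
  -- Row `i` of the left factor has a single nonzero entry, in column `i + u 1`.
  rw [Matrix.mul_apply, Finset.sum_eq_single
    ((ZMod.finEquiv p).symm (ZMod.finEquiv p i + u 1))]
  · simp only [weylMatrix, of_apply, RingEquiv.apply_symm_apply, if_true, Matrix.smul_apply, Pi.add_apply,
      add_assoc]
    split_ifs
    · rw [smul_eq_mul, ← Circle.coe_mul, ← Circle.coe_mul, ← AddChar.map_add_eq_mul,
        ← AddChar.map_add_eq_mul]
      congr 2
      simp only [halfForm]
      field_simp
      ring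
    · simp
  · intro k _ hk
    rw [weylMatrix, of_apply, if_neg, zero_mul]
    intro h
    exact hk (by rw [← h, RingEquiv.symm_apply_apply])
  · simp

lemma weylMatrix_zero : weylMatrix hζ 0 = 1 := by
  ext i j
  simp [weylMatrix, Matrix.one_apply, eq_comm]

lemma star_weylMatrix (hp : Odd p) (v : Fin 2 → ZMod p) :
    star (weylMatrix hζ v) = weylMatrix hζ (-v) := by
  have h2 := two_ne_zero_zmod hp
  ext i j
  rw [Matrix.star_eq_conjTranspose, conjTranspose_apply]
  simp only [weylMatrix, of_apply, Pi.neg_apply]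
  by_cases h : ZMod.finEquiv p i = ZMod.finEquiv p j + v 1
  · rw [if_pos h, if_pos (by rw [h]; ring), Complex.star_def, ← Circle.coe_inv_eq_conj,
      ← AddChar.map_neg_eq_inv, h]
    congr 2
    field_simp
    ring
  · rw [if_neg h, if_neg (by intro h'; apply h; rw [h']; ring), star_zero]

/-- The Weyl operator attached to `v`. -/
noncomputable def weylU (hp : Odd p) (v : Fin 2 → ZMod p) : Matrix.unitaryGroup (Fin p) ℂ :=
  ⟨weylMatrix hζ v, by
    rw [Matrix.mem_unitaryGroup_iff, star_weylMatrix hζ hp, weylMatrix_mul hζ hp, add_neg_cancel,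
      weylMatrix_zero]
    simp [halfForm, mul_comm]⟩

lemma weylU_mul (hp : Odd p) (u v : Fin 2 → ZMod p) :
    weylU hζ hp u * weylU hζ hp v =
      scalarU p (circleChar hζ (halfForm u v)) * weylU hζ hp (u + v) := by
  apply Subtype.ext
  rw [coe_scalarU_mul]
  exact weylMatrix_mul hζ hp u v

lemma weylU_zero (hp : Odd p) : weylU hζ hp 0 = 1 := Subtype.ext (weylMatrix_zero hζ)

lemma weylU_inv (hp : Odd p) (v : Fin 2 → ZMod p) : (weylU hζ hp v)⁻¹ = weylU hζ hp (-v) := by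
  rw [inv_eq_iff_mul_eq_one, weylU_mul, add_neg_cancel, weylU_zero]
  simp [halfForm, mul_comm]

lemma weylU_pow (hp : Odd p) (v : Fin 2 → ZMod p) (n : ℕ) :
    weylU hζ hp v ^ n = weylU hζ hp (n • v) := by
  induction n with
  | zero => rw [pow_zero, zero_smul, weylU_zero]
  | succ n ih =>
    rw [pow_succ, ih, weylU_mul, succ_nsmul]
    have : halfForm (n • v) v = 0 := by simp [halfForm]; right; ring
    rw [this, AddChar.map_zero_eq_one, map_one, one_mul]

lemma weylU_conj (hp : Odd p) (u v : Fin 2 → ZMod p) :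
    weylU hζ hp u * weylU hζ hp v * (weylU hζ hp u)⁻¹ =
      scalarU p (circleChar hζ (2 * halfForm u v)) * weylU hζ hp v := by
  rw [mul_inv_eq_iff_eq_mul, weylU_mul, mul_assoc, weylU_mul, ← mul_assoc, ← map_mul,
    ← AddChar.map_add_eq_mul, add_comm v u]
  congr 4
  simp only [halfForm]
  ring

lemma matA_eq_weylU (hp : Odd p) : matA hζ = weylU hζ hp ![1, 0] := by
  apply Subtype.ext
  ext i j
  simp only [matA, weylU, weylMatrix, of_apply, cons_val_zero, cons_val_one,
    add_zero, mul_zero, one_mul, diagonal_apply, EmbeddingLike.apply_eq_iff_eq, eq_comm (a := i)]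
  rw [← natCast_val_eq_finEquiv i, circleChar_natCast, Circle.coe_pow]
  rfl

lemma matB_eq_weylU (hp : Odd p) : matB p = weylU hζ hp ![0, 1] := by
  apply Subtype.ext
  ext i j
  simp only [matB, permU, weylU, weylMatrix, of_apply, cons_val_zero, cons_val_one,
    mul_zero, zero_mul, add_zero, AddChar.map_zero_eq_one, Circle.coe_one,
    Equiv.Perm.permMatrix, PEquiv.toMatrix_apply]
  simp only [Equiv.toPEquiv_apply, Option.mem_some_iff, finRotate_apply]
  congr 1
  rw [← finEquiv_apply_add_one, EmbeddingLike.apply_eq_iff_eq]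
  exact propext eq_comm

lemma matA_pow_mul_matB_pow (hp : Odd p) (v : Fin 2 → ZMod p) :
    matA hζ ^ (v 0).val * matB p ^ (v 1).val =
      scalarU p (circleChar hζ (halfForm ![v 0, 0] ![0, v 1])) * weylU hζ hp v := by
  rw [matA_eq_weylU hζ hp, matB_eq_weylU hζ hp, weylU_pow, weylU_pow]
  have h0 : (v 0).val • (![1, 0] : Fin 2 → ZMod p) = ![v 0, 0] := by
    ext i; fin_cases i <;> simp
  have h1 : (v 1).val • (![0, 1] : Fin 2 → ZMod p) = ![0, v 1] := by
    ext i; fin_cases i <;> simp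
  rw [h0, h1, weylU_mul]
  congr 2
  ext i; fin_cases i <;> simp

end Weyl

/-! ### The group `Γ`, its normalizer, and the action on labels. -/

section Normalizer

variable {p : ℕ} [Fact p.Prime] {ζ : ℂ} (hζ : IsPrimitiveRoot ζ p) (hp : Odd p)

/-- Schur's lemma by hand: `A` has distinct diagonal entries, so its commutant is diagonal, and
commuting with the shifts makes the diagonal constant. -/
lemma eq_smul_one_of_commute_weylMatrix {X : Matrix (Fin p) (Fin p) ℂ}
    (h : ∀ v, weylMatrix hζ v * X = X * weylMatrix hζ v) : ∃ c : ℂ, X = c • 1 := by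
  have hp : p ≠ 0 := NeZero.ne p
  have hd : X = diagonal fun i => X i i := by
    ext i j
    by_cases hij : i = j
    · rw [hij, diagonal_apply_eq]
    · rw [diagonal_apply_ne _ hij]
      have hA : weylMatrix hζ ![1, 0] = diagonal fun i : Fin p => ζ ^ (i : ℕ) := by
        ext i j
        simp only [weylMatrix, of_apply, cons_val_zero, cons_val_one, add_zero, mul_zero, one_mul,
          diagonal_apply, EmbeddingLike.apply_eq_iff_eq, eq_comm (a := i)]
        rw [← natCast_val_eq_finEquiv i, circleChar_natCast, Circle.coe_pow]
        rfl
      have h1 := congrFun (congrFun (h ![1, 0]) i) j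
      rw [hA, diagonal_mul, mul_diagonal, mul_comm, mul_eq_mul_left_iff] at h1
      refine h1.resolve_left fun h2 => hij (Fin.ext ?_)
      exact hζ.pow_inj i.2 j.2 h2
  refine ⟨X 0 0, ?_⟩
  rw [hd]
  ext i j
  by_cases hij : i = j
  · subst hij
    have h1 := congrFun (congrFun (h ![0, ZMod.finEquiv p i - ZMod.finEquiv p 0]) 0) i
    rw [hd, mul_diagonal, diagonal_mul] at h1
    simpa [weylMatrix] using h1
  · simp [diagonal_apply_ne _ hij, Matrix.one_apply_ne hij]

lemma exists_scalarU_of_commute_weylU {x : Matrix.unitaryGroup (Fin p) ℂ}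
    (h : ∀ v, weylU hζ hp v * x = x * weylU hζ hp v) : ∃ z, x = scalarU p z := by
  obtain ⟨c, hc⟩ := eq_smul_one_of_commute_weylMatrix hζ
    (fun v => congrArg (fun y : Matrix.unitaryGroup (Fin p) ℂ =>
      (y : Matrix (Fin p) (Fin p) ℂ)) (h v))
  exact exists_scalarU_eq hc

include hζ hp in
lemma mem_center_iff_scalarU {x : Matrix.unitaryGroup (Fin p) ℂ} :
    x ∈ Subgroup.center (Matrix.unitaryGroup (Fin p) ℂ) ↔ ∃ z, x = scalarU p z := by
  constructor
  · intro h
    exact exists_scalarU_of_commute_weylU hζ hp fun v => Subgroup.mem_center_iff.1 h _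
  · rintro ⟨z, rfl⟩
    exact Subgroup.mem_center_iff.2 fun y => (scalarU_comm z y).symm

lemma halfForm_nondegenerate {v : Fin 2 → ZMod p} (hp : Odd p)
    (h : ∀ u : Fin 2 → ZMod p, 2 * halfForm u v = 0) : v = 0 := by
  have h2 := two_ne_zero_zmod hp
  have h0 := h ![0, 1]
  have h1 := h ![1, 0]
  simp [halfForm, h2] at h0 h1
  ext i
  fin_cases i
  · exact h0
  · exact h1

/-- A scalar is fixed by conjugation by every `W(u)`, so `v` lies in the radical of the form. -/
lemma eq_zero_of_weylU_eq_scalarU {v : Fin 2 → ZMod p} {z : Circle}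
    (h : weylU hζ hp v = scalarU p z) : v = 0 := by
  refine halfForm_nondegenerate hp fun u => ?_
  have h1 := weylU_conj hζ hp u v
  rw [h, ← scalarU_comm, mul_inv_cancel_right, right_eq_mul] at h1
  rwa [← circleChar_eq_one_iff hζ, ← (scalarU_injective (p := p)).eq_iff, map_one]

lemma scalarU_mul_weylU_inj {z w : Circle} {u v : Fin 2 → ZMod p}
    (h : scalarU p z * weylU hζ hp u = scalarU p w * weylU hζ hp v) : z = w ∧ u = v := by
  have huv : u = v := by
    rw [← sub_eq_zero]
    have h1 : scalarU p z * (weylU hζ hp u * weylU hζ hp (-v)) = scalarU p w := by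
      rw [← mul_assoc, h, ← weylU_inv, mul_inv_cancel_right]
    rw [weylU_mul, ← mul_assoc, ← map_mul, ← eq_inv_mul_iff_mul_eq, ← map_inv, ← map_mul,
      ← sub_eq_add_neg] at h1
    exact eq_zero_of_weylU_eq_scalarU hζ hp h1
  subst huv
  exact ⟨scalarU_injective (mul_right_cancel h), rfl⟩

lemma scalarU_mem_Gam (hp : Odd p) (z : Circle) : scalarU p z ∈ Gam hζ :=
  Subgroup.subset_closure (Or.inr ((mem_center_iff_scalarU hζ hp).2 ⟨z, rfl⟩))

lemma weylU_mem_Gam (v : Fin 2 → ZMod p) : weylU hζ hp v ∈ Gam hζ := by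
  rw [eq_inv_mul_of_mul_eq (matA_pow_mul_matB_pow hζ hp v).symm, ← map_inv]
  refine mul_mem (scalarU_mem_Gam hζ hp _) (mul_mem (pow_mem ?_ _) (pow_mem ?_ _))
  · exact Subgroup.subset_closure (Or.inl (Or.inl rfl))
  · exact Subgroup.subset_closure (Or.inl (Or.inr rfl))

lemma mem_Gam_iff {x : Matrix.unitaryGroup (Fin p) ℂ} :
    x ∈ Gam hζ ↔ ∃ z v, x = scalarU p z * weylU hζ hp v := by
  constructor
  · intro h
    refine Subgroup.closure_induction (p := fun x _ => ∃ z v, x = scalarU p z * weylU hζ hp v)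
      ?_ ?_ ?_ ?_ h
    · rintro x ((rfl | rfl) | hx)
      · exact ⟨1, ![1, 0], by rw [map_one, one_mul, matA_eq_weylU hζ hp]⟩
      · exact ⟨1, ![0, 1], by rw [map_one, one_mul, matB_eq_weylU hζ hp]⟩
      · obtain ⟨z, rfl⟩ := (mem_center_iff_scalarU hζ hp).1 hx
        exact ⟨z, 0, by rw [weylU_zero, mul_one]⟩
    · exact ⟨1, 0, by rw [weylU_zero, mul_one, map_one]⟩
    · rintro _ _ _ _ ⟨z, u, rfl⟩ ⟨w, v, rfl⟩
      refine ⟨z * w * circleChar hζ (halfForm u v), u + v, ?_⟩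
      rw [map_mul, map_mul, mul_assoc (_ * _), ← weylU_mul, mul_assoc, ← mul_assoc (weylU _ _ _),
        ← scalarU_comm]
      simp only [mul_assoc]
    · rintro _ _ ⟨z, u, rfl⟩
      refine ⟨z⁻¹, -u, ?_⟩
      rw [scalarU_comm, _root_.mul_inv_rev, weylU_inv, map_inv]
  · rintro ⟨z, v, rfl⟩
    exact mul_mem (scalarU_mem_Gam hζ hp z) (weylU_mem_Gam hζ hp v)

/-- Conjugation by `x` carries the Weyl operator of `v` to that of `M *ᵥ v`, up to scalars. -/
def ActsOnWeyl (x : Matrix.unitaryGroup (Fin p) ℂ) (M : Matrix (Fin 2) (Fin 2) (ZMod p)) : Prop :=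
  ∀ v, ∃ z, x * weylU hζ hp v * x⁻¹ = scalarU p z * weylU hζ hp (M *ᵥ v)

variable {hζ hp} {x y : Matrix.unitaryGroup (Fin p) ℂ} {M N : Matrix (Fin 2) (Fin 2) (ZMod p)}

lemma ActsOnWeyl.mul (hx : ActsOnWeyl hζ hp x M) (hy : ActsOnWeyl hζ hp y N) :
    ActsOnWeyl hζ hp (x * y) (M * N) := by
  intro v
  obtain ⟨z, hz⟩ := hy v
  obtain ⟨w, hw⟩ := hx (N *ᵥ v)
  refine ⟨z * w, ?_⟩
  have : x * y * weylU hζ hp v * (x * y)⁻¹ = x * (y * weylU hζ hp v * y⁻¹) * x⁻¹ := by group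
  rw [this, hz, ← mul_assoc x, ← scalarU_comm, mul_assoc (scalarU p z), mul_assoc (scalarU p z), hw,
    ← mul_assoc, ← map_mul, mulVec_mulVec]

lemma ActsOnWeyl.inv (hx : ActsOnWeyl hζ hp x M) (h : M * N = 1) :
    ActsOnWeyl hζ hp x⁻¹ N := by
  intro v
  obtain ⟨z, hz⟩ := hx (N *ᵥ v)
  refine ⟨z⁻¹, ?_⟩
  rw [mulVec_mulVec, h, one_mulVec] at hz
  rw [map_inv, eq_inv_mul_iff_mul_eq, inv_inv, ← mul_assoc, ← mul_assoc, scalarU_comm, mul_assoc x⁻¹,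
    ← hz]
  group

lemma ActsOnWeyl.unique (hM : ActsOnWeyl hζ hp x M) (hN : ActsOnWeyl hζ hp x N) : M = N := by
  rw [← mulVec_injective.eq_iff]
  ext1 v
  obtain ⟨z, hz⟩ := hM v
  obtain ⟨w, hw⟩ := hN v
  exact (scalarU_mul_weylU_inj hζ hp (hz.symm.trans hw)).2

lemma ActsOnWeyl.of_mem_Gam (hx : x ∈ Gam hζ) : ActsOnWeyl hζ hp x 1 := by
  obtain ⟨z, u, rfl⟩ := (mem_Gam_iff hζ hp).1 hx
  intro v
  refine ⟨circleChar hζ (2 * halfForm u v), ?_⟩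
  rw [one_mulVec, ← weylU_conj, scalarU_comm]
  have : weylU hζ hp u * scalarU p z * weylU hζ hp v * (weylU hζ hp u * scalarU p z)⁻¹ =
    weylU hζ hp u * (scalarU p z * weylU hζ hp v) * (scalarU p z)⁻¹ * (weylU hζ hp u)⁻¹ := by group
  rw [this, scalarU_comm, ← mul_assoc, mul_inv_cancel_right]

lemma ActsOnWeyl.conj_mem_Gam (hx : ActsOnWeyl hζ hp x M) (hy : y ∈ Gam hζ) :
    x * y * x⁻¹ ∈ Gam hζ := by
  obtain ⟨z, u, rfl⟩ := (mem_Gam_iff hζ hp).1 hy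
  obtain ⟨w, hw⟩ := hx u
  rw [← mul_assoc, ← scalarU_comm, mul_assoc, mul_assoc, ← mul_assoc x, hw]
  exact mul_mem (scalarU_mem_Gam hζ hp z) (mul_mem (scalarU_mem_Gam hζ hp w)
    (weylU_mem_Gam hζ hp _))

/-- Invertibility of `M` is needed because normalizing means that conjugation by `x⁻¹` preserves `Γ`
as well. -/
lemma ActsOnWeyl.mem_normGam (hx : ActsOnWeyl hζ hp x M) (h : M * N = 1) : x ∈ normGam hζ := by
  rw [Subgroup.mem_normalizer_iff]
  refine fun y => ⟨hx.conj_mem_Gam, fun hy => ?_⟩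
  have := (hx.inv h).conj_mem_Gam hy
  convert this using 1
  group

lemma ActsOnWeyl.actsBy (hx : ActsOnWeyl hζ hp x M) : ActsBy hζ x M := by
  have key (j : Fin 2) (v : Fin 2 → ZMod p) (hv : M *ᵥ v = fun i => M i j) :
      x * weylU hζ hp v * x⁻¹ * (matA hζ ^ (M 0 j).val * matB p ^ (M 1 j).val)⁻¹ ∈
        Subgroup.center (Matrix.unitaryGroup (Fin p) ℂ) := by
    obtain ⟨z, hz⟩ := hx v
    rw [hv] at hz
    rw [hz, mem_center_iff_scalarU hζ hp]
    have : matA hζ ^ (M 0 j).val * matB p ^ (M 1 j).val =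
        scalarU p (circleChar hζ (halfForm ![M 0 j, 0] ![0, M 1 j])) *
          weylU hζ hp (fun i => M i j) := matA_pow_mul_matB_pow hζ hp (fun i => M i j)
    rw [this, _root_.mul_inv_rev, mul_assoc, mul_inv_cancel_left, ← map_inv, ← map_mul]
    exact ⟨_, rfl⟩
  refine ⟨?_, ?_⟩
  · have := key 0 ![1, 0] (by ext i; simp [mulVec, dotProduct])
    rwa [← matA_eq_weylU hζ hp] at this
  · have := key 1 ![0, 1] (by ext i; simp [mulVec, dotProduct])
    rwa [← matB_eq_weylU hζ hp] at this

lemma halfForm_mulVec (M : Matrix (Fin 2) (Fin 2) (ZMod p)) (u v : Fin 2 → ZMod p) :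
    halfForm (M *ᵥ u) (M *ᵥ v) = M.det * halfForm u v := by
  simp only [halfForm, det_fin_two, mulVec, dotProduct, Fin.sum_univ_two]
  ring

/-- Eliminates the unknown scalars `z u`, `z v`, `z (u + v)` from the two relations obtained by
multiplying Weyl operators in either order. -/
lemma mul_eq_mul_of_mul_eq_mul_swap {G : Type*} [CommGroup G] {a b c d s t w : G}
    (h1 : a * w = s * t * b) (h2 : c * w = t * s * d) : a * d = c * b := by
  refine mul_right_cancel (b := w * (s * t)) ?_
  calc a * d * (w * (s * t)) = (a * w) * (t * s * d) := by ac_rfl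
    _ = c * b * (w * (s * t)) := by rw [h1, ← h2]; ac_rfl

lemma exists_actsOnWeyl_of_mem_normGam (hp : Odd p) (hx : x ∈ normGam hζ) :
    ∃ M : SpecialLinearGroup (Fin 2) (ZMod p), ActsOnWeyl hζ hp x M := by
  have h (v : Fin 2 → ZMod p) : ∃ z u, x * weylU hζ hp v * x⁻¹ = scalarU p z * weylU hζ hp u :=
    (mem_Gam_iff hζ hp).1 ((Subgroup.mem_normalizer_iff.1 hx _).1 (weylU_mem_Gam hζ hp v))
  choose z f hf using h
  have hmul (u v : Fin 2 → ZMod p) :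
      x * (weylU hζ hp u * weylU hζ hp v) * x⁻¹ =
        scalarU p (z u * z v * circleChar hζ (halfForm (f u) (f v))) * weylU hζ hp (f u + f v) := by
    rw [map_mul, map_mul, mul_assoc (_ * _), ← weylU_mul]
    have : x * (weylU hζ hp u * weylU hζ hp v) * x⁻¹ =
      (x * weylU hζ hp u * x⁻¹) * (x * weylU hζ hp v * x⁻¹) := by group
    rw [this, hf, hf, mul_assoc, ← mul_assoc (weylU _ _ _), ← scalarU_comm]
    simp only [mul_assoc]
  have hmul' (u v : Fin 2 → ZMod p) :
      x * (weylU hζ hp u * weylU hζ hp v) * x⁻¹ =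
        scalarU p (circleChar hζ (halfForm u v) * z (u + v)) * weylU hζ hp (f (u + v)) := by
    rw [weylU_mul, ← mul_assoc, ← scalarU_comm, mul_assoc, mul_assoc, ← mul_assoc x, hf, map_mul,
      mul_assoc]
  -- Two evaluations of one conjugate: comparing labels gives additivity of `f`, comparing scalars
  -- gives the condition on the form.
  have hfz (u v : Fin 2 → ZMod p) := scalarU_mul_weylU_inj hζ hp ((hmul' u v).symm.trans (hmul u v))
  let F : (Fin 2 → ZMod p) →+ (Fin 2 → ZMod p) := AddMonoidHom.mk' f fun u v => (hfz u v).2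
  let M : Matrix (Fin 2) (Fin 2) (ZMod p) := LinearMap.toMatrix' (F.toZModLinearMap p)
  have hM (v : Fin 2 → ZMod p) : M *ᵥ v = f v := LinearMap.toMatrix'_mulVec _ v
  have hdet : M.det = 1 := by
    have h1 := (hfz ![0, 1] ![1, 0]).1
    have h2 := (hfz ![1, 0] ![0, 1]).1
    rw [add_comm ![1, 0]] at h2
    have h3 := mul_eq_mul_of_mul_eq_mul_swap h1 h2
    rw [← AddChar.map_add_eq_mul, ← AddChar.map_add_eq_mul] at h3
    have h4 := circleChar_injective hζ h3
    rw [← hM, ← hM, halfForm_mulVec, halfForm_mulVec] at h4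
    have h2 := two_ne_zero_zmod hp
    simp [halfForm] at h4
    field_simp at h4
    have h6 : (2 : ZMod p) * (M.det - 1) = 0 := by linear_combination -h4
    exact sub_eq_zero.1 ((mul_eq_zero.1 h6).resolve_left h2)
  exact ⟨⟨M, hdet⟩, fun v => ⟨z v, by rw [hf]; exact congrArg _ (congrArg _ (hM v).symm)⟩⟩

lemma commute_weylU_of_commute (hA : weylU hζ hp ![1, 0] * x = x * weylU hζ hp ![1, 0])
    (hB : weylU hζ hp ![0, 1] * x = x * weylU hζ hp ![0, 1]) (v : Fin 2 → ZMod p) :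
    weylU hζ hp v * x = x * weylU hζ hp v := by
  have h := eq_inv_mul_of_mul_eq (matA_pow_mul_matB_pow hζ hp v).symm
  rw [matA_eq_weylU hζ hp, matB_eq_weylU hζ hp, ← map_inv] at h
  rw [h]
  have hA' : Commute (weylU hζ hp ![1, 0]) x := hA
  have hB' : Commute (weylU hζ hp ![0, 1]) x := hB
  exact Commute.mul_left (scalarU_comm _ x) ((hA'.pow_left _).mul_left (hB'.pow_left _))

lemma ActsOnWeyl.mem_Gam (hx : ActsOnWeyl hζ hp x 1) : x ∈ Gam hζ := by
  have h (v : Fin 2 → ZMod p) : ∃ k, x * weylU hζ hp v * x⁻¹ =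
      scalarU p (circleChar hζ k) * weylU hζ hp v := by
    obtain ⟨z, hz⟩ := hx v
    rw [one_mulVec] at hz
    -- Since `p • v = 0`, the scalar by which conjugation changes `W(v)` is a `p`-th root of unity,
    -- hence a value of `ψ`.
    have h1 : weylU hζ hp v ^ p = 1 := by
      rw [weylU_pow, ← weylU_zero hζ hp]
      congr 1
      ext i
      simp
    have h2 := congrArg (· ^ p) hz
    rw [conj_pow, h1, (show Commute (scalarU p z) _ from scalarU_comm z _).mul_pow, h1, mul_one,
      mul_one, mul_inv_cancel, ← map_pow] at h2
    have h3 : z ^ p = 1 := scalarU_injective (p := p) (by rw [← h2, map_one])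
    obtain ⟨k, rfl⟩ := exists_circleChar_eq hζ h3
    exact ⟨k, hz⟩
  obtain ⟨k, hk⟩ := h ![1, 0]
  obtain ⟨l, hl⟩ := h ![0, 1]
  have h2 := two_ne_zero_zmod hp
  -- The label `![-l, k]` solves `2 * halfForm u v = k * v 0 + l * v 1`, so its Weyl operator
  -- conjugates `A` and `B` exactly as `x` does.
  have hcomm (v : Fin 2 → ZMod p) (m : ZMod p)
      (hm : x * weylU hζ hp v * x⁻¹ = scalarU p (circleChar hζ m) * weylU hζ hp v)
      (hu : 2 * halfForm ![-l, k] v = m) :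
      weylU hζ hp v * ((weylU hζ hp ![-l, k])⁻¹ * x) = (weylU hζ hp ![-l, k])⁻¹ * x *
        weylU hζ hp v := by
    have h1 := weylU_conj hζ hp ![-l, k] v
    rw [hu, ← hm] at h1
    have h3 : weylU hζ hp v * ((weylU hζ hp ![-l, k])⁻¹ * x) = (weylU hζ hp ![-l, k])⁻¹ *
        (weylU hζ hp ![-l, k] * weylU hζ hp v * (weylU hζ hp ![-l, k])⁻¹) * x := by group
    rw [h3, h1]
    group
  obtain ⟨z, hz⟩ := exists_scalarU_of_commute_weylU hζ hp
    (commute_weylU_of_commute (hcomm _ k hk (by simp [halfForm, h2]))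
      (hcomm _ l hl (by simp [halfForm, h2])))
  rw [inv_mul_eq_iff_eq_mul] at hz
  rw [hz]
  exact mul_mem (weylU_mem_Gam hζ hp _) (scalarU_mem_Gam hζ hp z)

end Normalizer

/-! ### Unitary intertwiners realizing each element of `SL₂(𝔽_p)`. -/

section Intertwiner

variable {p : ℕ} [Fact p.Prime] {ζ : ℂ} (hζ : IsPrimitiveRoot ζ p) (hp : Odd p)

-- Some `W(u)` conjugates `W(v)` to a nontrivial multiple of itself, while the trace is invariant
-- under conjugation.
include hp in
lemma trace_weylMatrix_eq_zero {v : Fin 2 → ZMod p} (hv : v ≠ 0) : (weylMatrix hζ v).trace = 0 := by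
  obtain ⟨u, hu⟩ : ∃ u : Fin 2 → ZMod p, 2 * halfForm u v ≠ 0 := by
    by_contra! h
    exact hv (halfForm_nondegenerate hp h)
  have h1 := congrArg (fun y : Matrix.unitaryGroup (Fin p) ℂ =>
    (y : Matrix (Fin p) (Fin p) ℂ).trace) (weylU_conj hζ hp u v)
  rw [coe_scalarU_mul, trace_smul] at h1
  have h2 : ((weylU hζ hp u * weylU hζ hp v * (weylU hζ hp u)⁻¹ :
      Matrix.unitaryGroup (Fin p) ℂ) : Matrix (Fin p) (Fin p) ℂ).trace =
        (weylU hζ hp v : Matrix (Fin p) (Fin p) ℂ).trace := by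
    rw [Submonoid.coe_mul, trace_mul_comm, ← Submonoid.coe_mul, ← mul_assoc, inv_mul_cancel, one_mul]
  rw [h2, smul_eq_mul] at h1
  by_contra h0
  have h3 := mul_right_cancel₀ h0 ((one_mul _).trans h1)
  exact hu ((circleChar_eq_one_iff hζ _).1 (Circle.coe_eq_one.1 h3.symm))

/-- Averaging `T` over the Weyl operators. -/
noncomputable def weylAverage (M : Matrix (Fin 2) (Fin 2) (ZMod p))
    (T : Matrix (Fin p) (Fin p) ℂ) : Matrix (Fin p) (Fin p) ℂ :=
  ∑ v, weylMatrix hζ (M *ᵥ v) * T * weylMatrix hζ (-v)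

lemma weylMatrix_mul_weylAverage (hp : Odd p) (M : Matrix.SpecialLinearGroup (Fin 2) (ZMod p))
    (T : Matrix (Fin p) (Fin p) ℂ) (u : Fin 2 → ZMod p) :
    weylMatrix hζ ((M : Matrix (Fin 2) (Fin 2) (ZMod p)) *ᵥ u) * weylAverage hζ (M : Matrix (Fin 2) (Fin 2) (ZMod p)) T = weylAverage hζ (M : Matrix (Fin 2) (Fin 2) (ZMod p)) T * weylMatrix hζ u := by
  rw [weylAverage, Finset.mul_sum, Finset.sum_mul]
  -- After translating the summation by `u`, both sides carry the same phase, because `det M = 1`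
  -- preserves the form.
  refine Fintype.sum_equiv (Equiv.addLeft u) _ _ fun v => ?_
  have h : halfForm u v = halfForm (-v + -u) u := by
    simp only [halfForm, Pi.add_apply, Pi.neg_apply]
    ring
  rw [← mul_assoc, ← mul_assoc, weylMatrix_mul hζ hp, mul_assoc _ (weylMatrix hζ (-_)),
    weylMatrix_mul hζ hp, halfForm_mulVec, M.det_coe, one_mul, ← mulVec_add, Equiv.coe_addLeft,
    mul_smul_comm, smul_mul_assoc, smul_mul_assoc, neg_add_rev, neg_add_cancel_right]
  rw [h]

lemma exists_weylAverage_ne_zero (hp : Odd p) (M : Matrix.SpecialLinearGroup (Fin 2) (ZMod p)) :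
    ∃ T, weylAverage hζ (M : Matrix (Fin 2) (Fin 2) (ZMod p)) T ≠ 0 := by
  by_contra! h
  -- Summing these entries over `i` turns the left factors into traces; only `v = 0` survives, and
  -- it contributes `p`.
  have h1 : ∑ i, weylAverage hζ (M : Matrix (Fin 2) (Fin 2) (ZMod p)) (Matrix.single i 0 1) i 0 = 0 := by simp [h]
  have h2 (i : Fin p) : weylAverage hζ (M : Matrix (Fin 2) (Fin 2) (ZMod p)) (Matrix.single i 0 1) i 0 =
      ∑ v, weylMatrix hζ ((M : Matrix (Fin 2) (Fin 2) (ZMod p)) *ᵥ v) i i * weylMatrix hζ (-v) 0 0 := by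
    rw [weylAverage, Matrix.sum_apply]
    refine Finset.sum_congr rfl fun v _ => ?_
    rw [mul_assoc, Matrix.mul_apply, Finset.sum_eq_single i]
    · simp
    · intro j _ hj
      rw [Matrix.single_mul_apply_of_ne _ _ _ _ _ hj, mul_zero]
    · simp
  simp only [h2] at h1
  rw [Finset.sum_comm, Finset.sum_eq_single 0] at h1
  · simp [weylMatrix_zero, NeZero.ne p] at h1
  · intro v _ hv
    rw [← Finset.sum_mul]
    have h3 := trace_weylMatrix_eq_zero hζ hp (v := (M : Matrix (Fin 2) (Fin 2) (ZMod p)) *ᵥ v) (by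
      intro h4
      apply hv
      have := congrArg (((M⁻¹ : Matrix.SpecialLinearGroup (Fin 2) (ZMod p)) : Matrix (Fin 2) (Fin 2) (ZMod p)) *ᵥ ·) h4
      rwa [mulVec_mulVec, ← Matrix.SpecialLinearGroup.coe_mul, inv_mul_cancel, Matrix.SpecialLinearGroup.coe_one,
        one_mulVec, mulVec_zero] at this)
    rw [trace] at h3
    simp only [diag_apply] at h3
    rw [h3, zero_mul]
  · simp

lemma exists_weylU_intertwiner (M : Matrix.SpecialLinearGroup (Fin 2) (ZMod p)) :
    ∃ x : Matrix.unitaryGroup (Fin p) ℂ, ∀ v,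
      x * weylU hζ hp v * x⁻¹ = weylU hζ hp ((M : Matrix (Fin 2) (Fin 2) (ZMod p)) *ᵥ v) := by
  obtain ⟨T, hT⟩ := exists_weylAverage_ne_zero hζ hp M
  set X := weylAverage hζ (M : Matrix (Fin 2) (Fin 2) (ZMod p)) T with hX
  have h1 (v : Fin 2 → ZMod p) := weylMatrix_mul_weylAverage hζ hp M T v
  rw [← hX] at h1
  have h2 (v : Fin 2 → ZMod p) : star X * weylMatrix hζ ((M : Matrix (Fin 2) (Fin 2) (ZMod p)) *ᵥ v) = weylMatrix hζ v * star X := by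
    have := congrArg star (h1 (-v))
    rwa [star_mul, star_mul, star_weylMatrix hζ hp, star_weylMatrix hζ hp, mulVec_neg, neg_neg,
      neg_neg] at this
  -- `X * star X` commutes with every `W(M u)`, hence with every `W(v)`, so it is a scalar;
  -- rescaling `X` by its square root gives a unitary.
  obtain ⟨c, hc⟩ := eq_smul_one_of_commute_weylMatrix hζ (X := X * star X) (fun v => by
    have h3 : v = (M : Matrix (Fin 2) (Fin 2) (ZMod p)) *ᵥ ((M⁻¹ : Matrix.SpecialLinearGroup (Fin 2) (ZMod p)) : Matrix (Fin 2) (Fin 2) (ZMod p)) *ᵥ v := by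
      rw [mulVec_mulVec, ← Matrix.SpecialLinearGroup.coe_mul, mul_inv_cancel, Matrix.SpecialLinearGroup.coe_one,
        one_mulVec]
    rw [h3, ← mul_assoc, h1, mul_assoc, mul_assoc, h2])
  obtain ⟨r, hr, rfl⟩ : ∃ r : ℝ, 0 ≤ r ∧ c = r := by
    refine ⟨∑ j, Complex.normSq (X 0 j), Finset.sum_nonneg fun j _ => Complex.normSq_nonneg _, ?_⟩
    have h3 := congrFun (congrFun hc 0) 0
    rw [Matrix.smul_apply, one_apply_eq, smul_eq_mul, mul_one, Matrix.mul_apply] at h3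
    rw [← h3, Complex.ofReal_sum]
    refine Finset.sum_congr rfl fun j _ => ?_
    rw [star_apply, Complex.star_def, Complex.mul_conj]
  have hr0 : r ≠ 0 := by
    rintro rfl
    open scoped ComplexOrder in
    rw [Complex.ofReal_zero, zero_smul, star_eq_conjTranspose, self_mul_conjTranspose_eq_zero] at hc
    exact hT hc
  have hs : ((√r : ℝ) : ℂ) * ((√r : ℝ) : ℂ) = r := by
    rw [← Complex.ofReal_mul, Real.mul_self_sqrt hr]
  have hs0 : ((√r : ℝ) : ℂ) ≠ 0 := by
    intro h
    rw [h, zero_mul] at hs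
    exact hr0 (by exact_mod_cast hs.symm)
  refine ⟨⟨((√r : ℝ) : ℂ)⁻¹ • X, ?_⟩, fun v => ?_⟩
  · rw [mem_unitaryGroup_iff, star_smul, smul_mul_smul_comm, hc, smul_smul, star_inv₀,
      Complex.star_def, Complex.conj_ofReal, ← hs]
    field_simp
    simp
  · rw [mul_inv_eq_iff_eq_mul]
    apply Subtype.ext
    rw [Submonoid.coe_mul, Submonoid.coe_mul]
    change (_ • X) * weylMatrix hζ v = weylMatrix hζ _ * (_ • X)
    rw [smul_mul_assoc, mul_smul_comm, h1]

end Intertwiner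

/-! ### The involution `τ` and its centralizer. -/

section Tau

variable {p : ℕ} [Fact p.Prime] {ζ : ℂ} (hζ : IsPrimitiveRoot ζ p) (hp : Odd p)

lemma coe_tauU_apply (i j : Fin p) :
    (tauU p : Matrix (Fin p) (Fin p) ℂ) i j = if j = -i then 1 else 0 := by
  simp only [tauU, permU, Equiv.Perm.permMatrix, PEquiv.toMatrix_apply, Equiv.toPEquiv_apply,
    Option.mem_some_iff, Equiv.neg_apply]
  congr 1
  exact propext eq_comm

lemma tauU_mul_self : tauU p * tauU p = 1 := by
  apply Subtype.ext
  ext i j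
  rw [Submonoid.coe_mul, Matrix.mul_apply, Finset.sum_eq_single (-i)]
  · simp [coe_tauU_apply, Matrix.one_apply, eq_comm]
  · intro k _ hk
    rw [coe_tauU_apply, if_neg hk, zero_mul]
  · simp

lemma tauU_inv : (tauU p)⁻¹ = tauU p := inv_eq_of_mul_eq_one_left tauU_mul_self

lemma star_coe_tauU : star (tauU p : Matrix (Fin p) (Fin p) ℂ) = tauU p :=
  congrArg (fun y : Matrix.unitaryGroup (Fin p) ℂ => (y : Matrix (Fin p) (Fin p) ℂ)) tauU_inv

lemma tauU_conj_weylU (v : Fin 2 → ZMod p) :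
    tauU p * weylU hζ hp v * (tauU p)⁻¹ = weylU hζ hp (-v) := by
  rw [mul_inv_eq_iff_eq_mul]
  apply Subtype.ext
  ext i j
  rw [Submonoid.coe_mul, Matrix.mul_apply, Finset.sum_eq_single (-i), Submonoid.coe_mul,
    Matrix.mul_apply, Finset.sum_eq_single (-j)]
  · rw [coe_tauU_apply, coe_tauU_apply, if_pos rfl, if_pos (neg_neg j).symm, one_mul, mul_one]
    simp only [weylU, weylMatrix, of_apply, finEquiv_apply_neg, Pi.neg_apply]
    refine if_congr ⟨fun h => ?_, fun h => ?_⟩ ?_ rfl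
    · rw [h]; ring
    · rw [← neg_inj, h]; ring
    · congr 2
      ring
  · intro k _ hk
    rw [coe_tauU_apply, if_neg (by rintro rfl; simp at hk), mul_zero]
  · simp
  · intro k _ hk
    rw [coe_tauU_apply, if_neg hk, zero_mul]
  · simp

lemma trace_tauU (hp : Odd p) : (tauU p : Matrix (Fin p) (Fin p) ℂ).trace = 1 := by
  rw [trace, Finset.sum_eq_single 0]
  · rw [diag_apply, coe_tauU_apply, if_pos]
    simp
  · intro i _ hi
    rw [diag_apply, coe_tauU_apply, if_neg]
    intro h
    have h1 := congrArg (ZMod.finEquiv p) h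
    rw [finEquiv_apply_neg, eq_neg_iff_add_eq_zero, ← two_mul] at h1
    exact hi ((map_eq_zero_iff _ (ZMod.finEquiv p).injective).1
      ((mul_eq_zero.1 h1).resolve_left (two_ne_zero_zmod hp)))
  · simp

lemma orderOf_tauU (hp : Odd p) : orderOf (tauU p) = 2 := by
  refine orderOf_eq_prime (by rw [sq, tauU_mul_self]) fun h => ?_
  have h1 := trace_tauU hp
  rw [h, Submonoid.coe_one, trace_one, Fintype.card_fin] at h1
  have : p = 1 := by exact_mod_cast h1
  exact (Fact.out : p.Prime).one_lt.ne' this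

lemma tauU_mem_normGam (hp : Odd p) : tauU p ∈ normGam hζ := by
  have h : ActsOnWeyl hζ hp (tauU p) (-1) := fun v => ⟨1, by
    rw [tauU_conj_weylU, map_one, one_mul, neg_mulVec, one_mulVec]⟩
  exact h.mem_normGam (N := -1) (by simp)

lemma exists_mem_centTau (M : Matrix.SpecialLinearGroup (Fin 2) (ZMod p)) :
    ∃ x ∈ centTau hζ, ActsOnWeyl hζ hp x ↑M := by
  obtain ⟨x, hx⟩ := exists_weylU_intertwiner hζ hp M
  have hxM : ActsOnWeyl hζ hp x ↑M := fun v => ⟨1, by rw [hx, map_one, one_mul]⟩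
  refine ⟨x, ⟨hxM.mem_normGam (N := ((M⁻¹ : Matrix.SpecialLinearGroup (Fin 2) (ZMod p)) : Matrix (Fin 2) (Fin 2) (ZMod p))) ?_, ?_⟩, hxM⟩
  · rw [← Matrix.SpecialLinearGroup.coe_mul, mul_inv_cancel, Matrix.SpecialLinearGroup.coe_one]
  -- Conjugation by this element negates the label twice, so it fixes every Weyl operator.
  obtain ⟨z, hz⟩ := exists_scalarU_of_commute_weylU hζ hp (x := x⁻¹ * tauU p * x * tauU p)
    (fun v => by
      rw [eq_comm, ← mul_inv_eq_iff_eq_mul]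
      have h1 : x⁻¹ * tauU p * x * tauU p * weylU hζ hp v * (x⁻¹ * tauU p * x * tauU p)⁻¹ =
          x⁻¹ * (tauU p * (x * (tauU p * weylU hζ hp v * (tauU p)⁻¹) * x⁻¹) * (tauU p)⁻¹) * x := by
        group
      rw [h1, tauU_conj_weylU, hx, tauU_conj_weylU, ← mulVec_neg, neg_neg, ← hx]
      group)
  have h4 : tauU p * x = x * scalarU p z * tauU p := by
    rw [← hz]
    simp only [mul_assoc, tauU_mul_self, mul_one, mul_inv_cancel_left]
  have h5 : x⁻¹ * tauU p * x = scalarU p z * tauU p := by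
    rw [mul_assoc, h4]; group
  -- Both `x⁻¹ τ x` and `τ` have trace `1`, which forces `z = 1`.
  have h6 := congrArg (fun y : Matrix.unitaryGroup (Fin p) ℂ =>
    (y : Matrix (Fin p) (Fin p) ℂ).trace) h5
  rw [coe_scalarU_mul, trace_smul, Submonoid.coe_mul, trace_mul_comm, ← Submonoid.coe_mul,
    mul_inv_cancel_left, trace_tauU hp, smul_eq_mul, mul_one] at h6
  have h7 : z = 1 := Circle.coe_eq_one.1 h6.symm
  rw [h7, map_one, mul_one] at h4
  exact Subgroup.mem_centralizer_singleton_iff.2 h4.symm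

end Tau

/-! ### Determinants attached to a projection. -/

section Det

/-- In an orthonormal eigenbasis the eigenvalues of `P` are `0` and `1`, and the trace counts the
ones. This evaluates `tauChar` on scalars. -/
lemma det_smul_add_one_sub_of_isIdempotentElem {n : Type*} [Fintype n] [DecidableEq n]
    {P : Matrix n n ℂ} (hP : P.IsHermitian) (hP2 : P * P = P) {m : ℕ} (hm : P.trace = m) (z : ℂ) :
    (z • P + (1 - P)).det = z ^ m := by
  set U := hP.eigenvectorUnitary
  set D : Matrix n n ℂ := diagonal (RCLike.ofReal ∘ hP.eigenvalues) with hD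
  have hPD : P = Unitary.conjStarAlgAut ℂ _ U D := hP.spectral_theorem
  have hdet (Y : Matrix n n ℂ) : (Unitary.conjStarAlgAut ℂ _ U Y).det = Y.det := by
    rw [Unitary.conjStarAlgAut_apply, det_mul_comm, ← mul_assoc, Unitary.coe_star_mul_self, one_mul]
  have htr : P.trace = D.trace := by
    rw [hPD, Unitary.conjStarAlgAut_apply, trace_mul_comm, ← mul_assoc, Unitary.coe_star_mul_self,
      one_mul]
  have hD2 : D * D = D := by
    apply (Unitary.conjStarAlgAut ℂ _ U).injective
    change Unitary.conjStarAlgAut ℂ _ U (D * D) = Unitary.conjStarAlgAut ℂ _ U D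
    rw [map_mul, ← hPD, hP2]
  have hev (i : n) : hP.eigenvalues i = 0 ∨ hP.eigenvalues i = 1 := by
    have h1 := congrFun (congrFun hD2 i) i
    rw [hD, diagonal_mul_diagonal, diagonal_apply_eq, diagonal_apply_eq] at h1
    have h2 : hP.eigenvalues i * hP.eigenvalues i = hP.eigenvalues i := by
      exact Complex.ofReal_injective (by rw [Complex.ofReal_mul]; exact h1)
    rcases mul_eq_zero.1 (show hP.eigenvalues i * (hP.eigenvalues i - 1) = 0 by
      rw [mul_sub, h2, mul_one, sub_self]) with h | h
    · exact Or.inl h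
    · exact Or.inr (sub_eq_zero.1 h)
  have h3 : z • P + (1 - P) = Unitary.conjStarAlgAut ℂ _ U (z • D + (1 - D)) := by
    rw [map_add, map_sub, map_one, map_smul, ← hPD]
  rw [h3, hdet, hD, ← diagonal_one, diagonal_sub, ← diagonal_smul, diagonal_add, det_diagonal]
  have h4 (i : n) : (z • (RCLike.ofReal ∘ hP.eigenvalues : n → ℂ)) i +
      (1 - (RCLike.ofReal ∘ hP.eigenvalues : n → ℂ) i) =
        if hP.eigenvalues i = 1 then z else 1 := by
    rcases hev i with h | h <;> simp [h]
  simp only [h4]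
  rw [Finset.prod_ite, Finset.prod_const, Finset.prod_const_one, mul_one]
  congr 1
  rw [htr, hD, trace_diagonal] at hm
  have h5 (i : n) : (RCLike.ofReal ∘ hP.eigenvalues : n → ℂ) i =
      if hP.eigenvalues i = 1 then 1 else 0 := by
    rcases hev i with h | h <;> simp [h]
  simp only [h5, Finset.sum_boole] at hm
  exact_mod_cast hm

end Det

/-! ### The character splitting off the scalars, and the topological isomorphism. -/

section Splitting

lemma norm_det_of_mem_unitaryGroup {n : Type*} [Fintype n] [DecidableEq n] {x : Matrix n n ℂ}
    (hx : x ∈ Matrix.unitaryGroup n ℂ) : ‖x.det‖ = 1 :=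
  CStarRing.norm_of_mem_unitary (det_of_mem_unitary hx)

variable {p : ℕ} [Fact p.Prime] {ζ : ℂ} (hζ : IsPrimitiveRoot ζ p) (hp : Odd p)

/-- The orthogonal projection onto the `1`-eigenspace of `τ`. -/
noncomputable def tauProj (p : ℕ) [NeZero p] : Matrix (Fin p) (Fin p) ℂ :=
  (2⁻¹ : ℂ) • (1 + (tauU p : Matrix (Fin p) (Fin p) ℂ))

lemma tauProj_mul_self : tauProj p * tauProj p = tauProj p := by
  have h : (tauU p : Matrix (Fin p) (Fin p) ℂ) * tauU p = 1 :=
    congrArg (fun y : Matrix.unitaryGroup (Fin p) ℂ => (y : Matrix (Fin p) (Fin p) ℂ))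
      tauU_mul_self
  rw [tauProj, smul_mul_smul_comm, add_mul, mul_add, mul_add, h, one_mul, one_mul, mul_one,
    add_comm (tauU p : Matrix (Fin p) (Fin p) ℂ) 1, ← two_smul ℂ, smul_smul]
  norm_num

lemma star_tauProj : star (tauProj p) = tauProj p := by
  rw [tauProj, star_smul, star_add, star_one, star_coe_tauU]
  norm_num

lemma trace_tauProj (hp : Odd p) : (tauProj p).trace = ((p + 1) / 2 : ℕ) := by
  have h : 2 ∣ p + 1 := (hp.add_odd odd_one).two_dvd
  rw [tauProj, trace_smul, trace_add, trace_tauU hp, trace_one, Fintype.card_fin,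
    Nat.cast_div h (by norm_num), smul_eq_mul]
  push_cast
  ring

/-- The matrix acting as `x` on the `1`-eigenspace of `τ` and trivially on its complement. -/
noncomputable def tauPart (x : Matrix (Fin p) (Fin p) ℂ) : Matrix (Fin p) (Fin p) ℂ :=
  tauProj p * x + (1 - tauProj p)

lemma commute_tauProj {x : Matrix.unitaryGroup (Fin p) ℂ}
    (hx : x ∈ Subgroup.centralizer {tauU p}) :
    Commute (tauProj p) (x : Matrix (Fin p) (Fin p) ℂ) := by
  have h : Commute (tauU p : Matrix (Fin p) (Fin p) ℂ) x :=
    (congrArg (fun y : Matrix.unitaryGroup (Fin p) ℂ => (y : Matrix (Fin p) (Fin p) ℂ))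
      (Subgroup.mem_centralizer_singleton_iff.1 hx)).symm
  exact ((Commute.one_left _).add_left h).smul_left _

lemma tauPart_mul {x y : Matrix (Fin p) (Fin p) ℂ} (hx : Commute (tauProj p) x) :
    tauPart (x * y) = tauPart x * tauPart y := by
  have h := tauProj_mul_self (p := p)
  have h1 : tauProj p * x * (tauProj p * y) = tauProj p * (x * y) := by
    rw [hx.eq, mul_assoc, ← mul_assoc (tauProj p), h, ← mul_assoc, ← hx.eq, mul_assoc]
  have h2 : tauProj p * x * (1 - tauProj p) = 0 := by
    rw [mul_sub, mul_one, hx.eq, mul_assoc, h, sub_self]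
  have h3 : (1 - tauProj p) * (tauProj p * y) = 0 := by
    rw [← mul_assoc, sub_mul, one_mul, h, sub_self, zero_mul]
  have h4 : (1 - tauProj p) * (1 - tauProj p) = 1 - tauProj p := by
    rw [sub_mul, one_mul, mul_sub, mul_one, h, sub_self, sub_zero]
  rw [tauPart, tauPart, tauPart, add_mul, mul_add, mul_add, h1, h2, h3, h4, add_zero, zero_add]

lemma tauPart_one : tauPart (1 : Matrix (Fin p) (Fin p) ℂ) = 1 := by
  rw [tauPart, mul_one, add_sub_cancel]

lemma star_tauPart {x : Matrix (Fin p) (Fin p) ℂ} (hx : Commute (tauProj p) x) :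
    star (tauPart x) = tauPart (star x) := by
  rw [tauPart, tauPart, hx.eq, star_add, star_mul, star_sub, star_one, star_tauProj]

lemma tauPart_mem_unitaryGroup {x : Matrix.unitaryGroup (Fin p) ℂ}
    (hx : x ∈ Subgroup.centralizer {tauU p}) :
    tauPart (x : Matrix (Fin p) (Fin p) ℂ) ∈ Matrix.unitaryGroup (Fin p) ℂ := by
  have h := commute_tauProj hx
  rw [mem_unitaryGroup_iff, star_tauPart h, ← tauPart_mul h, mem_unitaryGroup_iff.1 x.2, tauPart_one]

/-- The character `x ↦ det (x on the 1-eigenspace of τ) / det (x on the (-1)-eigenspace of τ)`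
of the centralizer of `τ`. -/
noncomputable def tauChar (p : ℕ) [Fact p.Prime] :
    Subgroup.centralizer {tauU p} →* Circle where
  toFun x := ⟨(tauPart (x : Matrix.unitaryGroup (Fin p) ℂ).1).det ^ 2 *
      star (x : Matrix.unitaryGroup (Fin p) ℂ).1.det, by
    refine mem_sphere_zero_iff_norm.2 ?_
    rw [norm_mul, norm_pow, norm_star, norm_det_of_mem_unitaryGroup (tauPart_mem_unitaryGroup x.2),
      norm_det_of_mem_unitaryGroup x.1.2, one_pow, one_mul]⟩
  map_one' := by
    apply Subtype.ext
    change (tauPart 1).det ^ 2 * star (1 : Matrix (Fin p) (Fin p) ℂ).det = 1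
    rw [tauPart_one, det_one, star_one, one_pow, one_mul]
  map_mul' x y := by
    apply Subtype.ext
    change (tauPart (x.1.1 * y.1.1)).det ^ 2 * star (x.1.1 * y.1.1).det =
      (tauPart x.1.1).det ^ 2 * star x.1.1.det * ((tauPart y.1.1).det ^ 2 * star y.1.1.det)
    rw [tauPart_mul (commute_tauProj x.2), det_mul, det_mul, star_mul']
    ring

lemma tauChar_scalarU (hp : Odd p) (z : Circle)
    (h : scalarU p z ∈ Subgroup.centralizer {tauU p}) : tauChar p ⟨scalarU p z, h⟩ = z := by
  apply Subtype.ext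
  change (tauPart ((z : ℂ) • (1 : Matrix (Fin p) (Fin p) ℂ))).det ^ 2 *
    star ((z : ℂ) • (1 : Matrix (Fin p) (Fin p) ℂ)).det = (z : ℂ)
  have h1 : ((p + 1) / 2) * 2 = p + 1 := Nat.div_mul_cancel (hp.add_odd odd_one).two_dvd
  have h2 : (z : ℂ) * star (z : ℂ) = 1 := by
    rw [Complex.star_def, Complex.mul_conj, Circle.normSq_coe, Complex.ofReal_one]
  -- The value is `z ^ (2 * ((p + 1) / 2))` times the conjugate of `z ^ p`, that is `z ^ (p + 1) * z
  -- ^ (-p)`.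
  rw [tauPart, mul_smul_comm, mul_one,
    det_smul_add_one_sub_of_isIdempotentElem star_tauProj tauProj_mul_self (trace_tauProj hp),
    det_smul, det_one, mul_one, Fintype.card_fin, star_pow, ← pow_mul, h1, pow_succ',
    mul_assoc, ← mul_pow, h2, one_pow, mul_one]

/-- The action of the normalizer of `Γ` on `Γ / S¹`. -/
noncomputable def weylAction : normGam hζ →* Matrix.SpecialLinearGroup (Fin 2) (ZMod p) :=
  MonoidHom.mk' (fun x => (exists_actsOnWeyl_of_mem_normGam hp x.2).choose) fun x y => by
    apply Subtype.ext
    exact ActsOnWeyl.unique (exists_actsOnWeyl_of_mem_normGam hp (x * y).2).choose_spec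
      ((exists_actsOnWeyl_of_mem_normGam hp x.2).choose_spec.mul
        (exists_actsOnWeyl_of_mem_normGam hp y.2).choose_spec)

lemma actsOnWeyl_weylAction (x : normGam hζ) : ActsOnWeyl hζ hp x (weylAction hζ hp x) :=
  (exists_actsOnWeyl_of_mem_normGam hp x.2).choose_spec

lemma weylAction_eq_iff {x : normGam hζ} {M : Matrix.SpecialLinearGroup (Fin 2) (ZMod p)} :
    weylAction hζ hp x = M ↔ ActsOnWeyl hζ hp x M := by
  constructor
  · rintro rfl
    exact actsOnWeyl_weylAction hζ hp x
  · intro h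
    apply Subtype.ext
    exact (actsOnWeyl_weylAction hζ hp x).unique h

/-- The extension of `SL₂(𝔽_p)` by `Γ` given by the normalizer of `Γ`. -/
noncomputable def weylExtension :
    GroupExtension (Gam hζ) (normGam hζ) (Matrix.SpecialLinearGroup (Fin 2) (ZMod p)) where
  inl := Subgroup.inclusion (Subgroup.le_normalizer (H := Gam hζ))
  rightHom := weylAction hζ hp
  inl_injective := Subgroup.inclusion_injective _
  range_inl_eq_ker_rightHom := by
    ext x
    rw [MonoidHom.mem_ker, weylAction_eq_iff, Matrix.SpecialLinearGroup.coe_one]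
    constructor
    · rintro ⟨y, rfl⟩
      exact ActsOnWeyl.of_mem_Gam y.2
    · intro h
      exact ⟨⟨x, h.mem_Gam⟩, rfl⟩
  rightHom_surjective M := by
    obtain ⟨x, hx, hM⟩ := exists_mem_centTau hζ hp M
    exact ⟨⟨x, hx.1⟩, (weylAction_eq_iff hζ hp).2 hM⟩

lemma scalarU_mem_centTau (hp : Odd p) (z : Circle) : scalarU p z ∈ centTau hζ :=
  ⟨Subgroup.le_normalizer (scalarU_mem_Gam hζ hp z),
    Subgroup.mem_centralizer_singleton_iff.2 (scalarU_comm z _)⟩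

/-- Commuting with `τ` forces `W(v) = W(-v)`, so `v = 0` because `p` is odd. -/
lemma exists_scalarU_eq_of_mem_Gam {x : Matrix.unitaryGroup (Fin p) ℂ} (hp : Odd p)
    (hx : x ∈ Gam hζ) (hτ : x ∈ Subgroup.centralizer {tauU p}) : ∃ z, x = scalarU p z := by
  obtain ⟨z, v, rfl⟩ := (mem_Gam_iff hζ hp).1 hx
  have h := Subgroup.mem_centralizer_singleton_iff.1 hτ
  have h1 : scalarU p z * weylU hζ hp v = scalarU p z * weylU hζ hp (-v) := by
    rw [← tauU_conj_weylU, ← mul_assoc, ← mul_assoc, eq_mul_inv_iff_mul_eq, h, ← mul_assoc,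
      scalarU_comm]
  have h2 := (scalarU_mul_weylU_inj hζ hp h1).2
  have h3 : v = 0 := by
    ext i
    have h4 := congrFun h2 i
    rw [Pi.neg_apply, eq_neg_iff_add_eq_zero, ← two_mul] at h4
    exact (mul_eq_zero.1 h4).resolve_left (two_ne_zero_zmod hp)
  exact ⟨z, by rw [h3, weylU_zero, mul_one]⟩

/-- The pair formed by `tauChar` and the action on `Γ / S¹`. -/
noncomputable def centTauHom : centTau hζ →* Circle × Matrix.SpecialLinearGroup (Fin 2) (ZMod p) :=
  ((tauChar p).comp (Subgroup.inclusion inf_le_right)).prod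
    ((weylAction hζ hp).comp (Subgroup.inclusion inf_le_left))

lemma centTauHom_scalarU (z : Circle) :
    centTauHom hζ hp ⟨scalarU p z, scalarU_mem_centTau hζ hp z⟩ = (z, 1) :=
  Prod.ext (tauChar_scalarU hp z _)
    ((weylAction_eq_iff hζ hp).2 (ActsOnWeyl.of_mem_Gam (scalarU_mem_Gam hζ hp z)))

lemma centTauHom_bijective : Function.Bijective (centTauHom hζ hp) := by
  constructor
  · rw [injective_iff_map_eq_one]
    intro x hx
    have h1 : weylAction hζ hp ⟨x, x.2.1⟩ = 1 := congrArg Prod.snd hx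
    rw [weylAction_eq_iff] at h1
    obtain ⟨z, hz⟩ := exists_scalarU_eq_of_mem_Gam hζ hp (ActsOnWeyl.mem_Gam h1) x.2.2
    obtain rfl : x = ⟨scalarU p z, scalarU_mem_centTau hζ hp z⟩ := Subtype.ext hz
    rw [centTauHom_scalarU] at hx
    have h2 : z = 1 := congrArg Prod.fst hx
    apply Subtype.ext
    change scalarU p z = 1
    rw [h2, map_one]
  · rintro ⟨z, M⟩
    obtain ⟨x, hx, hM⟩ := exists_mem_centTau hζ hp M
    have h1 : (centTauHom hζ hp ⟨x, hx⟩).2 = M :=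
      (weylAction_eq_iff hζ hp (x := ⟨x, hx.1⟩)).2 hM
    -- A scalar factor changes `tauChar` by that scalar and leaves the action alone, so it corrects
    -- the first coordinate of any lift of `M`.
    refine ⟨⟨_, scalarU_mem_centTau hζ hp (z * (centTauHom hζ hp ⟨x, hx⟩).1⁻¹)⟩ * ⟨x, hx⟩, ?_⟩
    rw [map_mul, centTauHom_scalarU]
    exact Prod.ext (inv_mul_cancel_right _ _) ((one_mul _).trans h1)

/-- The isomorphism of the product of the circle and `SL₂(𝔽_p)` with the centralizer of `τ` in
the normalizer of `Γ`. -/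
noncomputable def centTauEquiv :
    Circle × Matrix.SpecialLinearGroup (Fin 2) (ZMod p) ≃* centTau hζ :=
  (MulEquiv.ofBijective (centTauHom hζ hp) (centTauHom_bijective hζ hp)).symm

lemma centTauHom_centTauEquiv (a : Circle × Matrix.SpecialLinearGroup (Fin 2) (ZMod p)) :
    centTauHom hζ hp (centTauEquiv hζ hp a) = a :=
  (MulEquiv.ofBijective (centTauHom hζ hp) (centTauHom_bijective hζ hp)).apply_symm_apply a

lemma centTauEquiv_apply_one (z : Circle) :
    centTauEquiv hζ hp (z, 1) = ⟨scalarU p z, scalarU_mem_centTau hζ hp z⟩ := by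
  apply (centTauHom_bijective hζ hp).1
  rw [centTauHom_centTauEquiv, centTauHom_scalarU]

lemma continuous_scalarU {p : ℕ} : Continuous (scalarU p) :=
  Continuous.subtype_mk ((continuous_subtype_val (p := (· ∈ Submonoid.unitSphere ℂ))).smul continuous_const) _

lemma continuous_centTauEquiv : Continuous (centTauEquiv hζ hp) := by
  have h (a : Circle × Matrix.SpecialLinearGroup (Fin 2) (ZMod p)) : centTauEquiv hζ hp a =
      ⟨scalarU p a.1, scalarU_mem_centTau hζ hp a.1⟩ * centTauEquiv hζ hp (1, a.2) := by
    rw [← centTauEquiv_apply_one, ← map_mul, Prod.mk_mul_mk, mul_one, one_mul]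
  rw [funext h]
  have h1 : Continuous fun M : Matrix.SpecialLinearGroup (Fin 2) (ZMod p) =>
    centTauEquiv hζ hp (1, M) := continuous_of_discreteTopology
  exact (Continuous.subtype_mk (continuous_scalarU.comp continuous_fst) _).mul
    (h1.comp continuous_snd)

/-- `centTauEquiv` as an isomorphism of topological groups. -/
noncomputable def centTauContinuousEquiv :
    (Circle × Matrix.SpecialLinearGroup (Fin 2) (ZMod p)) ≃ₜ* centTau hζ where
  __ := centTauEquiv hζ hp
  continuous_toFun := continuous_centTauEquiv hζ hp
  continuous_invFun :=
    -- A continuous bijection from a compact space, here the circle times a finite discrete group,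
    -- to a Hausdorff space is a homeomorphism.
    (Continuous.homeoOfEquivCompactToT2 (f := (centTauEquiv hζ hp).toEquiv)
      (continuous_centTauEquiv hζ hp)).continuous_invFun

/-- The section of `weylExtension` with values in the centralizer of `τ`. -/
noncomputable def weylSplitting : (weylExtension hζ hp).Splitting where
  __ := (Subgroup.inclusion inf_le_left).comp
    ((centTauEquiv hζ hp).toMonoidHom.comp
      (MonoidHom.inr Circle (Matrix.SpecialLinearGroup (Fin 2) (ZMod p))))
  rightInverse_rightHom M := congrArg Prod.snd (centTauHom_centTauEquiv hζ hp (1, M))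

end Splitting
theorem mainTheorem7 (p : ℕ) [Fact p.Prime] (hp : Odd p) (ζ : ℂ) (hζ : IsPrimitiveRoot ζ p) :
    tauU p ∈ normGam hζ ∧ orderOf (tauU p) = 2 ∧
    ∃ E : GroupExtension (Gam hζ) (normGam hζ) (Matrix.SpecialLinearGroup (Fin 2) (ZMod p)),
      E.inl = Subgroup.inclusion (Subgroup.le_normalizer (H := Gam hζ)) ∧
      (∀ x : normGam hζ, ActsBy hζ x (E.rightHom x : Matrix (Fin 2) (Fin 2) (ZMod p))) ∧
      ∃ s : E.Splitting,
        ∃ e : (Circle × Matrix.SpecialLinearGroup (Fin 2) (ZMod p)) ≃ₜ* centTau hζ,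
          (∀ z : Circle,
            ((e (z, 1) : Matrix.unitaryGroup (Fin p) ℂ) : Matrix (Fin p) (Fin p) ℂ) =
              (z : ℂ) • (1 : Matrix (Fin p) (Fin p) ℂ)) ∧
          ∀ g : Matrix.SpecialLinearGroup (Fin 2) (ZMod p),
            ((s g : normGam hζ) : Matrix.unitaryGroup (Fin p) ℂ) =
              (e (1, g) : Matrix.unitaryGroup (Fin p) ℂ) := by
  refine ⟨tauU_mem_normGam hζ hp, orderOf_tauU hp, weylExtension hζ hp, rfl,
    fun x => (actsOnWeyl_weylAction hζ hp x).actsBy, weylSplitting hζ hp,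
    centTauContinuousEquiv hζ hp, fun z => ?_, fun g => rfl⟩
  exact congrArg (fun y : centTau hζ => ((y : Matrix.unitaryGroup (Fin p) ℂ) :
    Matrix (Fin p) (Fin p) ℂ)) (centTauEquiv_apply_one hζ hp z)
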